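/- Let $d\ge 1$ and $k\ge 1$ be integers. For $n\ge 0$ let $\mathcal D_n$ be the family of half-open dyadic cubes of side $2^{-n}$ contained in $[0,1)^d$; for $x\in[0,1)^d$ let $\mathcal D_n(x)$ be the cube of $\mathcal D_n$ containing $x$, and for $Q\in\mathcal D_n$ and $j\ge 1$ let $\mathcal D_j(Q)=\{R\in\mathcal D_{n+j}:R\subset Q\}$. For a Borel probability measure $\mu$ on $[0,1)^d$ put $$\mathrm{por}_2(\mu,x,n,\varepsilon)=\min\Big\{j\ge 1:\min_{R\in\mathcal D_j(\mathcal D_n(x))}\frac{\mu(R)}{\mu(\mathcal D_n(x))}\le\varepsilon\Big\}\qquad(\min\emptyset=\infty).$$ For $0<\eta\le 1$ and $0\le\varepsilon<1$, call $\mu$ dyadic mean $(k,\eta,\varepsilon)$-porous if $$\liminf_{n\to\infty}\frac1n\big|\{0\le i<n:\mathrm{por}_2(\mu,x,i,\varepsilon)\le k\}\big|\ge\eta\quad\text{for }\mu\text{-a.e. }x.$$ Let $\dim_P\mu$ be the packing dimension of $\mu$, that is, the $\mu$-essential supremum over $x$ of $\limsup_{r\to0^+}\log\mu(B(x,r))/\log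 r$, where $B(x,r)$ is the closed ball. **Theorem.** For every $\varepsilon\in[0,2^{-kd}]$ the equation $$(1-\varepsilon)\log\left(\frac{(2^d-1)\sum_{i=1}^k2^{-si}}{1-\varepsilon}\right)+\varepsilon\log(1/\varepsilon)=s\,\varepsilon\log(2^k)$$ (natural logarithms, $0\log(1/0)=0$) has a largest real solution $s=s_{d,k}(\varepsilon)$. Put $t_{d,k}(\varepsilon)=d-s_{d,k}(\varepsilon)$. Then for every $\eta\in(0,1]$ and every dyadic mean $(k,\eta,\varepsilon)$-porous Borel probability measure $\mu$ on $[0,1)^d$, $$\dim_P\mu\le d-\eta\,t_{d,k}(\varepsilon).$$ Moreover: (i) $t_{d,k}(\varepsilon)>0$ whenever $0\le\varepsilon<2^{-kd}$; (ii) there is $\delta>0$, depending only on $d$ and $k$, such that $t_{d,k}(\varepsilon)>\dfrac{2}{5\log2}\,2^{-kd}$ for all $\varepsilon\in[0,2^{-kd}]$ with $\varepsilon<\delta$. -/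

import Mathlib

open MeasureTheory Filter Topology

namespace DyadicPorosity

noncomputable section

/-- The half-open unit cube `[0,1)^d`. -/
def unitCube (d : ℕ) : Set (EuclideanSpace ℝ (Fin d)) :=
  {y | ∀ i, 0 ≤ y i ∧ y i < 1}

/-- The half-open cube of side `2 ^ (-n)` whose lower corner is `2 ^ (-n) * m`. -/
def dyadicCube {d : ℕ} (n : ℕ) (m : Fin d → ℤ) : Set (EuclideanSpace ℝ (Fin d)) :=
  {y | ∀ i, (m i : ℝ) / 2 ^ n ≤ y i ∧ y i < ((m i : ℝ) + 1) / 2 ^ n}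

/-- The family of the dyadic cubes of level `n` in the unit cube. -/
def dyadicCubes (d n : ℕ) : Set (Set (EuclideanSpace ℝ (Fin d))) :=
  {Q | (∃ m : Fin d → ℤ, Q = dyadicCube n m) ∧ Q ⊆ unitCube d}

/-- The dyadic cube of level `n` that contains `x`. -/
def cubeAt {d : ℕ} (n : ℕ) (x : EuclideanSpace ℝ (Fin d)) :
    Set (EuclideanSpace ℝ (Fin d)) :=
  dyadicCube n (fun i => ⌊(2 : ℝ) ^ n * x i⌋)

/-- For `Q` a dyadic cube of level `n`: its dyadic sub-cubes of level `n + k`. -/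
def subCubes {d : ℕ} (n k : ℕ) (Q : Set (EuclideanSpace ℝ (Fin d))) :
    Set (Set (EuclideanSpace ℝ (Fin d))) :=
  {R | R ∈ dyadicCubes d (n + k) ∧ R ⊆ Q}

/-- The least `k ≥ 1` such that some dyadic sub-cube of relative level `k` of the level-`n` cube
containing `x` has relative `μ`-mass at most `ε`; it is `⊤` if there is no such `k`. -/
def por2 {d : ℕ} (μ : Measure (EuclideanSpace ℝ (Fin d)))
    (x : EuclideanSpace ℝ (Fin d)) (n : ℕ) (ε : ℝ) : ℕ∞ :=
  sInf {j : ℕ∞ | ∃ k : ℕ, 1 ≤ k ∧ j = (k : ℕ∞) ∧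
    ∃ R ∈ subCubes n k (cubeAt n x), μ.real R / μ.real (cubeAt n x) ≤ ε}

open Classical in
/-- Dyadic mean `(k, η, ε)`-porosity of a measure. -/
def IsDyadicMeanPorous {d : ℕ} (k : ℕ) (η ε : ℝ)
    (μ : Measure (EuclideanSpace ℝ (Fin d))) : Prop :=
  ∀ᵐ x ∂μ, η ≤ liminf (fun n : ℕ =>
    (((Finset.range n).filter (fun i => por2 μ x i ε ≤ (k : ℕ∞))).card : ℝ) / (n : ℝ)) atTop

/-- The upper local dimension of `μ` at `x`, with `log 0 = -∞`. -/
def upperLocalDim {d : ℕ} (μ : Measure (EuclideanSpace ℝ (Fin d)))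
    (x : EuclideanSpace ℝ (Fin d)) : EReal :=
  limsup (fun r : ℝ => ENNReal.log (μ (Metric.closedBall x r)) / ((Real.log r : ℝ) : EReal))
    (𝓝[>] 0)

/-- The packing dimension of `μ`: the essential supremum of the upper local dimensions. -/
def packingDim {d : ℕ} (μ : Measure (EuclideanSpace ℝ (Fin d))) : EReal :=
  essSup (upperLocalDim μ) μ

/-- The equation in `s` whose largest solution is `sRoot d k ε`. -/
def RootEquation (d k : ℕ) (ε s : ℝ) : Prop :=
  (1 - ε) * Real.log
      (((2 : ℝ) ^ d - 1) * (∑ i ∈ Finset.Icc 1 k, (2 : ℝ) ^ (-(s * (i : ℝ)))) / (1 - ε))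
    + ε * Real.log (1 / ε) = s * ε * Real.log ((2 : ℝ) ^ k)

/-- The largest real solution of the equation (a genuine maximum where it exists). -/
def sRoot (d k : ℕ) (ε : ℝ) : ℝ := sSup {s : ℝ | RootEquation d k ε s}

/-- The dimension drop. -/
def tDrop (d k : ℕ) (ε : ℝ) : ℝ := (d : ℝ) - sRoot d k ε

end

end DyadicPorosity

/-! Fix `s = sRoot d k ε`, `t = d - s`, and put `Z = holeWeight d k s`, `X = 2 ^ (-s k)`. The root
equation says `(1 - ε) log (Z / (1 - ε)) + ε log (X / ε) = 0`. Here `X` is the Gibbs weight of a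
hole `k` generations deep, and `Z` is the total weight of the siblings split off on the way down to
it, `2 ^ d - 1` of them of weight `2 ^ (-s i)` at each depth `i`.

The dimension bound is a moment estimate. Sum `μ(Q) ^ (1 - l)` over the cubes of generation `m`,
normalised by `2 ^ (-d l m)`, and reward every porous ancestor by `exp (l t log 2)`. By Hölder, a
generation below a non-porous cube does not increase this sum. Below a porous cube the sum is
expanded along the path to the hole, and Hölder reduces the claim to a two-point inequality
(`exists_hole_moment_le`). As `l → 0` its first-order term is the root equation, so for small `l`
the moments grow at most like `exp (l δ m)` (`treeMoment_le`). Markov and Borel–Cantelli then show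
that almost surely each porous scale lowers `-log μ(Q)` by `t log 2`, up to an error `n δ`
(`ae_eventually_neg_log_le`). Comparing cubes with balls finishes the bound.

The gap between the two sides of the equation is strictly decreasing in `s`, so its sign at a point
locates the root. At `s = d` it is minus the relative entropy of the laws `(1 - ε, ε)` and `(1 - 2 ^
(-k d), 2 ^ (-k d))`, which gives (i). At `ε = 0` the equation reads `Z = 1`; an explicit estimate
of the geometric sum and continuity in `ε` give (ii). -/

namespace DyadicPorosity

noncomputable section

/-! ### The root equation: existence, uniqueness and sign -/

/-- The total weight `(2 ^ d - 1) * ∑ 2 ^ (-s i)` of the complement of a hole of depth `k`. -/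
def holeWeight (d k : ℕ) (s : ℝ) : ℝ :=
  ((2 : ℝ) ^ d - 1) * ∑ i ∈ Finset.Icc 1 k, (2 : ℝ) ^ (-(s * (i : ℝ)))

/-- The difference of the two sides of `RootEquation`. -/
def rootGap (d k : ℕ) (ε s : ℝ) : ℝ :=
  (1 - ε) * Real.log (holeWeight d k s / (1 - ε)) + ε * Real.log (1 / ε)
    - s * ε * Real.log ((2 : ℝ) ^ k)

lemma rootEquation_iff {d k : ℕ} {ε s : ℝ} : RootEquation d k ε s ↔ rootGap d k ε s = 0 := by
  unfold RootEquation rootGap holeWeight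
  rw [sub_eq_zero]

lemma one_le_two_pow_sub_one {d : ℕ} (hd : 1 ≤ d) : (1 : ℝ) ≤ 2 ^ d - 1 := by
  have := pow_le_pow_right₀ (by norm_num : (1 : ℝ) ≤ 2) hd
  linarith

lemma holeWeight_pos {d k : ℕ} (hd : 1 ≤ d) (hk : 1 ≤ k) (s : ℝ) : 0 < holeWeight d k s := by
  have := one_le_two_pow_sub_one hd
  refine mul_pos (by linarith) (Finset.sum_pos (fun i _ => by positivity) ?_)
  exact ⟨1, by simp [hk]⟩

lemma holeWeight_strictAnti {d k : ℕ} (hd : 1 ≤ d) (hk : 1 ≤ k) :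
    StrictAnti (holeWeight d k) := by
  intro s t hst
  have := one_le_two_pow_sub_one hd
  refine mul_lt_mul_of_pos_left (Finset.sum_lt_sum_of_nonempty ⟨1, by simp [hk]⟩ ?_) (by linarith)
  intro i hi
  have hi1 : 1 ≤ i := (Finset.mem_Icc.mp hi).1
  have : (0 : ℝ) < i := by exact_mod_cast hi1
  exact Real.rpow_lt_rpow_of_exponent_lt (by norm_num) (by nlinarith)

lemma continuous_holeWeight (d k : ℕ) : Continuous (holeWeight d k) := by
  unfold holeWeight
  refine continuous_const.mul (continuous_finsetSum _ fun i _ => ?_)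
  exact (Real.continuous_const_rpow (by norm_num)).comp (by fun_prop)

/-- A geometric series; the value at `s = d` is the mass of the complement of the hole. -/
lemma holeWeight_natCast (d k : ℕ) : holeWeight d k d = 1 - 1 / 2 ^ (k * d) := by
  have h2 : (2 : ℝ) ^ d ≠ 0 := by positivity
  unfold holeWeight
  induction k with
  | zero => simp
  | succ k ih =>
    rw [Finset.sum_Icc_succ_top (by omega), mul_add, ih]
    have : (2 : ℝ) ^ (-((d : ℝ) * ((k + 1 : ℕ) : ℝ))) = 1 / (2 ^ (k * d) * 2 ^ d) := by
      rw [Real.rpow_neg (by norm_num), one_div]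
      congr 1
      rw [← pow_add, ← Real.rpow_natCast]
      congr 1
      push_cast
      ring
    rw [this, add_mul, one_mul, pow_add]
    field_simp
    ring

lemma holeProb_mem {d k : ℕ} (hd : 1 ≤ d) (hk : 1 ≤ k) :
    (0 : ℝ) < 1 / 2 ^ (k * d) ∧ (1 : ℝ) / 2 ^ (k * d) ≤ 1 / 2 ^ d ∧ (1 : ℝ) / 2 ^ d ≤ 1 / 2 := by
  refine ⟨by positivity, ?_, ?_⟩
  · exact one_div_le_one_div_of_le (by positivity)
      (pow_le_pow_right₀ (by norm_num) (Nat.le_mul_of_pos_left d hk))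
  · refine one_div_le_one_div_of_le (by positivity) ?_
    simpa using pow_le_pow_right₀ (by norm_num : (1 : ℝ) ≤ 2) hd

lemma rootGap_strictAnti {d k : ℕ} (hd : 1 ≤ d) (hk : 1 ≤ k) {ε : ℝ} (h0 : 0 ≤ ε) (h1 : ε < 1) :
    StrictAnti (rootGap d k ε) := by
  intro s t hst
  have hlog : Real.log (holeWeight d k t / (1 - ε)) < Real.log (holeWeight d k s / (1 - ε)) :=
    Real.log_lt_log (div_pos (holeWeight_pos hd hk t) (by linarith))
      (div_lt_div_of_pos_right (holeWeight_strictAnti hd hk hst) (by linarith))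
  have hk0 : 0 ≤ Real.log ((2 : ℝ) ^ k) := Real.log_nonneg (one_le_pow₀ (by norm_num))
  have hA : (1 - ε) * Real.log (holeWeight d k t / (1 - ε))
      < (1 - ε) * Real.log (holeWeight d k s / (1 - ε)) :=
    mul_lt_mul_of_pos_left hlog (by linarith)
  have hB : s * ε * Real.log ((2 : ℝ) ^ k) ≤ t * ε * Real.log ((2 : ℝ) ^ k) := by gcongr
  unfold rootGap
  linarith

lemma continuous_rootGap {d k : ℕ} (hd : 1 ≤ d) (hk : 1 ≤ k) {ε : ℝ} (h1 : ε < 1) :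
    Continuous (rootGap d k ε) := by
  unfold rootGap
  have hl : Continuous fun s => Real.log (holeWeight d k s / (1 - ε)) :=
    ((continuous_holeWeight d k).div_const _).log
      fun s => (div_pos (holeWeight_pos hd hk s) (by linarith)).ne'
  fun_prop

lemma mul_log_div_le {x y : ℝ} (hx : 0 ≤ x) (hy : 0 < y) : x * Real.log (y / x) ≤ y - x := by
  rcases hx.eq_or_lt with rfl | hx
  · simpa using hy.le
  · have h := mul_le_mul_of_nonneg_left (Real.log_le_sub_one_of_pos (div_pos hy hx)) hx.le
    have e : x * (y / x - 1) = y - x := by field_simp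
    linarith

/-- Since the complement of the hole has weight `1 - 2 ^ (-k d)` at `s = d`, the gap there is minus
a relative entropy; its sign then follows from `log u ≤ u - 1`. -/
lemma rootGap_natCast {d k : ℕ} {ε : ℝ} (h0 : 0 ≤ ε) :
    rootGap d k ε d = (1 - ε) * Real.log ((1 - 1 / 2 ^ (k * d)) / (1 - ε))
      + ε * Real.log (1 / 2 ^ (k * d) / ε) := by
  unfold rootGap
  rw [holeWeight_natCast]
  rcases h0.eq_or_lt with rfl | hε
  · simp
  · have e1 : Real.log (1 / 2 ^ (k * d) / ε) = - ((k * d : ℕ) * Real.log 2) - Real.log ε := by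
      rw [Real.log_div (by positivity) hε.ne', one_div, Real.log_inv, Real.log_pow]
    rw [e1, one_div ε, Real.log_inv, Real.log_pow]
    push_cast
    ring

lemma rootGap_natCast_nonpos {d k : ℕ} (hd : 1 ≤ d) (hk : 1 ≤ k) {ε : ℝ} (h0 : 0 ≤ ε)
    (h1 : ε < 1) : rootGap d k ε d ≤ 0 := by
  obtain ⟨hp, hp', hp''⟩ := holeProb_mem hd hk
  rw [rootGap_natCast h0]
  have a := mul_log_div_le (x := 1 - ε) (y := 1 - 1 / 2 ^ (k * d)) (by linarith) (by linarith)
  have b := mul_log_div_le h0 hp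
  linarith

lemma rootGap_natCast_neg {d k : ℕ} (hd : 1 ≤ d) (hk : 1 ≤ k) {ε : ℝ} (h0 : 0 ≤ ε)
    (h1 : ε < 1 / 2 ^ (k * d)) : rootGap d k ε d < 0 := by
  obtain ⟨hp, hp', hp''⟩ := holeProb_mem hd hk
  rw [rootGap_natCast h0]
  have h1ε : 0 < 1 - ε := by linarith
  have a : (1 - ε) * Real.log ((1 - 1 / 2 ^ (k * d)) / (1 - ε)) < ε - 1 / 2 ^ (k * d) := by
    have hne : (1 - 1 / 2 ^ (k * d)) / (1 - ε) ≠ 1 := by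
      rw [Ne, div_eq_one_iff_eq h1ε.ne']
      intro h
      linarith
    have h := mul_lt_mul_of_pos_left
      (Real.log_lt_sub_one_of_pos (div_pos (by linarith) h1ε) hne) h1ε
    have e : (1 - ε) * ((1 - 1 / 2 ^ (k * d)) / (1 - ε) - 1) = ε - 1 / 2 ^ (k * d) := by
      field_simp
      ring
    linarith
  have b := mul_log_div_le h0 hp
  linarith

lemma rootGap_zero_nonneg {d k : ℕ} (hd : 1 ≤ d) (hk : 1 ≤ k) {ε : ℝ} (h0 : 0 ≤ ε) (h1 : ε < 1) :
    0 ≤ rootGap d k ε 0 := by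
  have hA : 1 ≤ holeWeight d k 0 := by
    have h := one_le_two_pow_sub_one hd
    have hk' : (1 : ℝ) ≤ k := by exact_mod_cast hk
    simp only [holeWeight, zero_mul, neg_zero, Real.rpow_zero, Finset.sum_const, Nat.card_Icc,
      add_tsub_cancel_right, nsmul_eq_mul, mul_one]
    nlinarith
  have a : 0 ≤ Real.log (holeWeight d k 0 / (1 - ε)) :=
    Real.log_nonneg ((one_le_div (by linarith)).2 (by linarith))
  have b : 0 ≤ ε * Real.log (1 / ε) := by
    rcases h0.eq_or_lt with rfl | hε
    · simp
    · exact mul_nonneg h0 (Real.log_nonneg ((one_le_div hε).2 h1.le))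
  unfold rootGap
  nlinarith [mul_nonneg (by linarith : 0 ≤ 1 - ε) a]

lemma lt_one_of_mem {d k : ℕ} (hd : 1 ≤ d) (hk : 1 ≤ k) {ε : ℝ}
    (hε : ε ∈ Set.Icc (0 : ℝ) (1 / 2 ^ (k * d))) : ε < 1 := by
  obtain ⟨hp, hp', hp''⟩ := holeProb_mem hd hk
  linarith [hε.2]

/-- The gap is nonnegative at `0` and nonpositive at `d`, and strict monotonicity leaves only one
root; thus the supremum defining `sRoot` is attained. -/
lemma setOf_rootEquation {d k : ℕ} (hd : 1 ≤ d) (hk : 1 ≤ k) {ε : ℝ}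
    (hε : ε ∈ Set.Icc (0 : ℝ) (1 / 2 ^ (k * d))) :
    {s | RootEquation d k ε s} = {sRoot d k ε} ∧ sRoot d k ε ≤ d := by
  have h1 := lt_one_of_mem hd hk hε
  obtain ⟨s, hs, hs0⟩ := intermediate_value_Icc' (Nat.cast_nonneg d)
    (continuous_rootGap hd hk h1).continuousOn
    ⟨rootGap_natCast_nonpos hd hk hε.1 h1, rootGap_zero_nonneg hd hk hε.1 h1⟩
  have hset : {s | RootEquation d k ε s} = {s} := by
    ext u
    simp only [Set.mem_ofPred_eq, Set.mem_singleton_iff, rootEquation_iff, ← hs0]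
    exact (rootGap_strictAnti hd hk hε.1 h1).injective.eq_iff
  have : sRoot d k ε = s := by rw [sRoot, hset, csSup_singleton]
  exact ⟨by rw [this, hset], by rw [this]; exact hs.2⟩

lemma rootGap_sRoot {d k : ℕ} (hd : 1 ≤ d) (hk : 1 ≤ k) {ε : ℝ}
    (hε : ε ∈ Set.Icc (0 : ℝ) (1 / 2 ^ (k * d))) : rootGap d k ε (sRoot d k ε) = 0 := by
  rw [← rootEquation_iff]
  change sRoot d k ε ∈ {s | RootEquation d k ε s}
  rw [(setOf_rootEquation hd hk hε).1]
  rfl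

lemma sRoot_lt_of_rootGap_neg {d k : ℕ} (hd : 1 ≤ d) (hk : 1 ≤ k) {ε s : ℝ}
    (hε : ε ∈ Set.Icc (0 : ℝ) (1 / 2 ^ (k * d))) (h : rootGap d k ε s < 0) :
    sRoot d k ε < s := by
  rw [← rootGap_sRoot hd hk hε] at h
  exact (rootGap_strictAnti hd hk hε.1 (lt_one_of_mem hd hk hε)).lt_iff_gt.1 h

/-! ### The dimension drop for small `ε` -/

lemma mul_sum_Icc_pow (r : ℝ) (k : ℕ) :
    (1 - r) * ∑ i ∈ Finset.Icc 1 k, r ^ i = r - r ^ (k + 1) := by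
  induction k with
  | zero => simp
  | succ k ih =>
    rw [Finset.sum_Icc_succ_top (by omega), mul_add, ih]
    ring

/-- With `q = 2 ^ (-d)`, `p = 2 ^ (-k d)` and `a = 2 p / 5`, the sum is geometric with ratio `q *
exp a`, and the claim becomes `exp a - 1 < (1 - q) * p * exp a ^ (k + 1)`. As `1 - q ≥ 1 / 2` and
`exp a - 1 ≤ a * exp a`, it is enough that `2 / 5 < 1 / 2`. -/
lemma holeWeight_lt_one {d k : ℕ} (hd : 1 ≤ d) (hk : 1 ≤ k) :
    holeWeight d k (d - 2 / (5 * Real.log 2) * (1 / 2 ^ (k * d))) < 1 := by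
  obtain ⟨hp, hpq, hq⟩ := holeProb_mem hd hk
  set p : ℝ := 1 / 2 ^ (k * d) with hpdef
  set q : ℝ := 1 / 2 ^ d with hqdef
  have hq0 : 0 < q := by positivity
  have hl2 : 0 < Real.log 2 := Real.log_pos (by norm_num)
  set a : ℝ := 2 / 5 * p with ha
  have ha0 : 0 < a := by positivity
  set r : ℝ := q * Real.exp a with hr
  have hterm : ∀ i : ℕ, (2 : ℝ) ^ (-((d - 2 / (5 * Real.log 2) * p) * (i : ℝ))) = r ^ i := by
    intro i
    rw [hr, hqdef, Real.rpow_def_of_pos (by norm_num), one_div, ← Real.exp_log (x := 2 ^ d)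
      (by positivity), ← Real.exp_neg, ← Real.exp_add, ← Real.exp_nat_mul, Real.log_pow, ha]
    congr 1
    field_simp
    ring
  have hqk : q ^ k = p := by rw [hqdef, hpdef, one_div_pow, ← pow_mul, mul_comm d k]
  have hexp : Real.exp a - 1 ≤ a * Real.exp a := by
    have h := Real.add_one_le_exp (-a)
    have h2 : Real.exp (-a) * Real.exp a = 1 := by rw [← Real.exp_add]; simp
    nlinarith [Real.exp_pos a]
  have hea : 1 < Real.exp a := Real.one_lt_exp_iff.2 ha0
  have hea2 : Real.exp a < 2 := by nlinarith
  have hr1 : r < 1 := by rw [hr]; nlinarith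
  have hrk : r ^ (k + 1) = q * p * Real.exp a ^ (k + 1) := by
    rw [hr, mul_pow, pow_succ q, hqk]; ring
  have hek : Real.exp a ≤ Real.exp a ^ (k + 1) := le_self_pow₀ hea.le (by omega)
  have hsum : holeWeight d k (d - 2 / (5 * Real.log 2) * p)
      = (1 / q - 1) * ∑ i ∈ Finset.Icc 1 k, r ^ i := by
    unfold holeWeight
    simp only [hterm]
    rw [hqdef, one_div_one_div]
  rw [hsum]
  have hg := mul_sum_Icc_pow r k
  set S := ∑ i ∈ Finset.Icc 1 k, r ^ i
  have key : (1 - q) * (r - r ^ (k + 1)) < q * (1 - r) := by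
    rw [hrk, hr]
    have h3 : Real.exp a - 1 < (1 - q) * p * Real.exp a ^ (k + 1) := by
      have : (1 / 2) * p * Real.exp a ≤ (1 - q) * p * Real.exp a ^ (k + 1) := by
        refine mul_le_mul (mul_le_mul_of_nonneg_right (by linarith) hp.le) hek
          (Real.exp_pos a).le (mul_nonneg (by linarith) hp.le)
      have hpe : 0 < p * Real.exp a := mul_pos hp (Real.exp_pos a)
      have hae : a * Real.exp a = 2 / 5 * (p * Real.exp a) := by rw [ha]; ring
      linarith
    nlinarith
  have h4 : (1 - r) * ((1 - q) * S) < (1 - r) * q := by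
    have : (1 - r) * ((1 - q) * S) = (1 - q) * ((1 - r) * S) := by ring
    rw [this, hg]
    linarith
  have h5 : (1 - q) * S < q := lt_of_mul_lt_mul_left h4 (by linarith)
  have h6 : (1 / q - 1) * S = ((1 - q) * S) / q := by field_simp
  rw [h6, div_lt_one hq0]
  exact h5

lemma exists_rootGap_neg_near_zero {d k : ℕ} (hd : 1 ≤ d) (hk : 1 ≤ k) {s : ℝ}
    (hs : holeWeight d k s < 1) : ∃ δ > 0, ∀ ε, 0 ≤ ε → ε < δ → rootGap d k ε s < 0 := by
  have hpos := holeWeight_pos hd hk s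
  have hc : ContinuousAt (fun ε => rootGap d k ε s) 0 := by
    have h1 : ContinuousAt (fun ε : ℝ => Real.log (holeWeight d k s / (1 - ε))) 0 := by
      refine ContinuousAt.log (ContinuousAt.div (by fun_prop) (by fun_prop) (by simp)) ?_
      simpa using hpos.ne'
    have h2 : ContinuousAt (fun ε : ℝ => ε * Real.log (1 / ε)) 0 := by
      have : (fun ε : ℝ => ε * Real.log (1 / ε)) = Real.negMulLog := by
        funext x
        rw [one_div, Real.log_inv, Real.negMulLog]
        ring
      rw [this]
      exact Real.continuous_negMulLog.continuousAt
    unfold rootGap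
    fun_prop
  have h0 : rootGap d k 0 s < 0 := by
    simpa [rootGap] using Real.log_neg hpos hs
  obtain ⟨δ, hδ, h⟩ := Metric.eventually_nhds_iff.1 (hc.eventually_lt continuousAt_const h0)
  refine ⟨δ, hδ, fun ε h1 h2 => h ?_⟩
  rwa [Real.dist_eq, sub_zero, abs_of_nonneg h1]

/-! ### The two-point inequality and Hölder -/

/-- Before the critical value `2 ^ (-k d)` the hole carries less than its Gibbs weight. -/
lemma mul_holeWeight_le {d k : ℕ} (hd : 1 ≤ d) {ε s : ℝ} (h0 : 0 ≤ ε)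
    (h1 : ε ≤ 1 / 2 ^ (k * d)) (hs : s ≤ d) :
    ε * holeWeight d k s ≤ (1 - ε) * (2 : ℝ) ^ (-(s * (k : ℝ))) := by
  have hd1 := one_le_two_pow_sub_one hd
  set X : ℝ := (2 : ℝ) ^ (-(s * (k : ℝ))) with hX
  have hXpos : 0 < X := by positivity
  -- Termwise this is `(d - s) * i ≤ (d - s) * k`: the ratio of `X` to the hole weight is smallest
  -- at `s = d`, where it equals that of `2 ^ (-k d)` to `1 - 2 ^ (-k d)`.
  have hle : holeWeight d k s ≤ X * 2 ^ (k * d) * holeWeight d k d := by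
    unfold holeWeight
    rw [mul_left_comm]
    refine mul_le_mul_of_nonneg_left ?_ (by linarith)
    rw [Finset.mul_sum]
    refine Finset.sum_le_sum fun i hi => ?_
    have hik : (i : ℝ) ≤ k := by exact_mod_cast (Finset.mem_Icc.1 hi).2
    rw [hX, ← Real.rpow_natCast 2 (k * d), ← Real.rpow_add (by norm_num),
      ← Real.rpow_add (by norm_num)]
    refine Real.rpow_le_rpow_of_exponent_le (by norm_num) ?_
    push_cast
    nlinarith
  rw [holeWeight_natCast] at hle
  have hP : (0 : ℝ) < 2 ^ (k * d) := by positivity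
  have e : X * 2 ^ (k * d) * (1 - 1 / 2 ^ (k * d)) = X * (2 ^ (k * d) - 1) := by field_simp
  rw [e] at hle
  rw [le_div_iff₀ hP] at h1
  calc ε * holeWeight d k s ≤ ε * (X * (2 ^ (k * d) - 1)) := by gcongr
    _ = (ε * 2 ^ (k * d) - ε) * X := by ring
    _ ≤ (1 - ε) * X := by gcongr

/-- The left side has value `1` and, by `hmean`, derivative `0` at `l = 0`, whereas `exp (l * δ) ≥ 1
+ l * δ`. -/
lemma exists_exp_mean_le {a b ε δ : ℝ} (hmean : (1 - ε) * a + ε * b = 0) (hδ : 0 < δ) :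
    ∃ l : ℝ, 0 < l ∧ l < 1 ∧
      (1 - ε) * Real.exp (l * a) + ε * Real.exp (l * b) ≤ Real.exp (l * δ) := by
  have h1 : ∀ c : ℝ, HasDerivAt (fun l : ℝ => Real.exp (l * c)) c 0 := fun c => by
    have := ((hasDerivAt_id (0 : ℝ)).mul_const c).exp
    simpa using this
  have h : HasDerivAt (fun l : ℝ => (1 - ε) * Real.exp (l * a) + ε * Real.exp (l * b)) 0 0 := by
    have := ((h1 a).const_mul (1 - ε)).add ((h1 b).const_mul ε)
    rwa [hmean] at this
  have ho := (hasDerivAt_iff_isLittleO.1 h).def hδ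
  have ho' : ∀ᶠ l : ℝ in 𝓝[>] 0, l < 1 ∧ 0 < l ∧
      ‖(1 - ε) * Real.exp (l * a) + ε * Real.exp (l * b) - ((1 - ε) + ε)‖ ≤ δ * ‖l‖ := by
    filter_upwards [eventually_nhdsWithin_of_eventually_nhds (gt_mem_nhds one_pos),
      self_mem_nhdsWithin, ho.filter_mono nhdsWithin_le_nhds] with l hl1 hl0 hl
    exact ⟨hl1, hl0, by simpa using hl⟩
  obtain ⟨l, hl1, hl0, hl⟩ := ho'.exists
  refine ⟨l, hl0, hl1, ?_⟩
  rw [Real.norm_eq_abs, Real.norm_eq_abs, abs_of_pos hl0] at hl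
  have := Real.add_one_le_exp (l * δ)
  have := le_abs_self ((1 - ε) * Real.exp (l * a) + ε * Real.exp (l * b) - ((1 - ε) + ε))
  linarith

lemma rpow_mul_rpow_eq {x e Z l : ℝ} (he : 0 < e) (hZ : 0 < Z) :
    x ^ (1 - l) * Z ^ l = x ^ (1 - l) * e ^ l * Real.exp (l * Real.log (Z / e)) := by
  rw [mul_assoc, ← Real.log_rpow (div_pos hZ he), Real.exp_log (by positivity),
    Real.div_rpow hZ.le he.le]
  have : e ^ l ≠ 0 := by positivity
  field_simp

lemma rpow_mul_rpow_le_mean {x y l : ℝ} (hx : 0 ≤ x) (hy : 0 ≤ y) (h0 : 0 ≤ l) (h1 : l ≤ 1) :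
    x ^ (1 - l) * y ^ l ≤ (1 - l) * x + l * y :=
  Real.geom_mean_le_arith_mean2_weighted (by linarith) h0 hx hy (by ring)

/-- A first-order form of the variational principle behind the root equation. -/
lemma exists_hole_moment_le {d k : ℕ} (hd : 1 ≤ d) (hk : 1 ≤ k) {ε : ℝ}
    (hε : ε ∈ Set.Icc (0 : ℝ) (1 / 2 ^ (k * d))) {δ : ℝ} (hδ : 0 < δ) :
    ∃ l : ℝ, 0 < l ∧ l < 1 ∧ ∀ W R : ℝ, 0 ≤ W → 0 ≤ R → R ≤ ε * W →
      (W - R) ^ (1 - l) * holeWeight d k (sRoot d k ε) ^ l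
        + R ^ (1 - l) * ((2 : ℝ) ^ (-(sRoot d k ε * (k : ℝ)))) ^ l
        ≤ Real.exp (l * δ) * W ^ (1 - l) := by
  have hroot := rootGap_sRoot hd hk hε
  have hε1 := lt_one_of_mem hd hk hε
  have hgibbs := mul_holeWeight_le hd hε.1 hε.2 (setOf_rootEquation hd hk hε).2
  set s := sRoot d k ε
  have hZ := holeWeight_pos hd hk s
  set Z := holeWeight d k s with hZdef
  have hX : (0 : ℝ) < (2 : ℝ) ^ (-(s * (k : ℝ))) := by positivity
  set X : ℝ := (2 : ℝ) ^ (-(s * (k : ℝ))) with hXdef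
  -- For `ε = 0` the root equation is `Z = 1` and the hole is null, so any `l` in `(0, 1)` would do.
  rcases hε.1.eq_or_lt with h0 | h0
  · refine ⟨1 / 2, by norm_num, by norm_num, fun W R hW hR hRW => ?_⟩
    have hZ1 : Z = 1 := by
      rw [← h0] at hroot
      simp only [rootGap, sub_zero, div_one, one_mul, zero_mul, mul_zero, add_zero] at hroot
      exact Real.eq_one_of_pos_of_log_eq_zero hZ hroot
    have hR0 : R = 0 := by rw [← h0] at hRW; linarith
    rw [hR0, hZ1]
    have := Real.one_le_exp (x := 1 / 2 * δ) (by positivity)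
    have hW' := Real.rpow_nonneg hW (1 - 1 / 2)
    rw [Real.zero_rpow (by norm_num)]
    simp only [sub_zero, Real.one_rpow, mul_one, zero_mul, add_zero]
    nlinarith
  · have hmean : (1 - ε) * Real.log (Z / (1 - ε)) + ε * Real.log (X / ε) = 0 := by
      rw [← hroot, rootGap, ← hZdef, Real.log_div hX.ne' h0.ne', one_div, Real.log_inv, hXdef,
        Real.log_rpow (by norm_num), Real.log_pow]
      ring
    obtain ⟨l, hl0, hl1, hl⟩ := exists_exp_mean_le hmean hδ
    refine ⟨l, hl0, hl1, fun W R hW hR hRW => ?_⟩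
    rcases hW.eq_or_lt with rfl | hW
    · have : R = 0 := by linarith
      simp [this, Real.zero_rpow (by linarith : 1 - l ≠ 0)]
    -- By homogeneity it suffices to treat `W = 1`.
    have hscale : ∀ r, 0 ≤ r → r ≤ ε →
        (1 - r) ^ (1 - l) * Z ^ l + r ^ (1 - l) * X ^ l ≤ Real.exp (l * δ) := by
      intro r hr hrε
      rw [rpow_mul_rpow_eq (sub_pos.2 hε1) hZ, rpow_mul_rpow_eq h0 hX]
      -- This is where `ε ≤ 2 ^ (-k d)` enters: mass moved into the hole raises the bound, so `r =
      -- ε` is the worst case.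
      have hab : Real.exp (l * Real.log (Z / (1 - ε))) ≤ Real.exp (l * Real.log (X / ε)) := by
        refine Real.exp_le_exp.2 (mul_le_mul_of_nonneg_left (Real.log_le_log ?_ ?_) hl0.le)
        · exact div_pos hZ (by linarith)
        · rw [div_le_div_iff₀ (by linarith) h0]
          linarith
      have ha := Real.exp_pos (l * Real.log (Z / (1 - ε)))
      set a := Real.exp (l * Real.log (Z / (1 - ε)))
      set b := Real.exp (l * Real.log (X / ε))
      -- Arithmetic–geometric mean against the reference law `(1 - ε, ε)` makes the bound affine in
      -- `r`.
      have e1 := rpow_mul_rpow_le_mean (x := 1 - r) (y := 1 - ε) (by linarith) (by linarith)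
        hl0.le hl1.le
      have e2 := rpow_mul_rpow_le_mean hr h0.le hl0.le hl1.le
      have f1 := mul_le_mul_of_nonneg_right e1 ha.le
      have f2 := mul_le_mul_of_nonneg_right e2 (ha.le.trans hab)
      nlinarith [mul_nonneg (mul_nonneg (sub_nonneg.2 hl1.le) (sub_nonneg.2 hrε))
        (sub_nonneg.2 hab)]
    have h := hscale (R / W) (by positivity) ((div_le_iff₀ hW).2 hRW)
    have e1 : W - R = (1 - R / W) * W := by field_simp
    have hRW1 : 0 ≤ 1 - R / W := by
      have := (div_le_iff₀ hW).2 hRW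
      linarith
    have e2 : R ^ (1 - l) = (R / W) ^ (1 - l) * W ^ (1 - l) := by
      rw [← Real.mul_rpow (by positivity) hW.le, div_mul_cancel₀ _ hW.ne']
    rw [e1, e2, Real.mul_rpow hRW1 hW.le]
    have := mul_le_mul_of_nonneg_right h (Real.rpow_nonneg hW.le (1 - l))
    linarith

lemma holder_two {A B X Y l : ℝ} (hA : 0 ≤ A) (hB : 0 ≤ B) (hX : 0 ≤ X) (hY : 0 ≤ Y)
    (h0 : 0 < l) (h1 : l < 1) :
    A ^ (1 - l) * X ^ l + B ^ (1 - l) * Y ^ l ≤ (A + B) ^ (1 - l) * (X + Y) ^ l := by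
  have h1l : 0 < 1 - l := by linarith
  have hpq : (1 / (1 - l)).HolderConjugate (1 / l) := by
    rw [Real.holderConjugate_iff]
    refine ⟨(one_lt_div h1l).2 (by linarith), by simp⟩
  have e : ∀ x : ℝ, 0 ≤ x → ∀ t : ℝ, 0 < t → (x ^ t) ^ t⁻¹ = x := fun x hx t ht => by
    rw [← Real.rpow_mul hx, mul_inv_cancel₀ ht.ne', Real.rpow_one]
  have h := Real.inner_le_Lp_mul_Lq_of_nonneg (Finset.univ : Finset (Fin 2)) hpq
    (f := ![A ^ (1 - l), B ^ (1 - l)]) (g := ![X ^ l, Y ^ l])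
    (by intro i _; fin_cases i <;> simp <;> positivity)
    (by intro i _; fin_cases i <;> simp <;> positivity)
  simpa [Fin.sum_univ_two, e _ hA _ h1l, e _ hB _ h1l, e _ hX _ h0, e _ hY _ h0] using h

lemma holder_sum {ι : Type*} (S : Finset ι) {w : ι → ℝ} (hw : ∀ i, 0 ≤ w i) {l : ℝ}
    (h0 : 0 < l) (h1 : l < 1) :
    ∑ i ∈ S, w i ^ (1 - l) ≤ (∑ i ∈ S, w i) ^ (1 - l) * (S.card : ℝ) ^ l := by
  classical
  induction S using Finset.induction_on with
  | empty => simp [Real.zero_rpow h0.ne']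
  | insert a S ha ih =>
    rw [Finset.sum_insert ha, Finset.sum_insert ha, Finset.card_insert_of_notMem ha]
    have h := holder_two (hw a) (Finset.sum_nonneg fun i (_ : i ∈ S) => hw i) zero_le_one
      (Nat.cast_nonneg S.card) h0 h1
    rw [Real.one_rpow, mul_one] at h
    push_cast
    rw [add_comm (S.card : ℝ) 1]
    linarith

/-! ### Weighted moments on a regular tree -/

section Tree

variable {T A : Type*} [Fintype A]

/-- The sum over the descendants `u` of generation `m` of `t` of
`w u ^ (1 - l) * exp (l * c * #{porous proper ancestors of u down from t}) / |A| ^ (l * m)`. -/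
def treeMoment (child : T → A → T) (w : T → ℝ) (P : T → Prop) (l c : ℝ) : ℕ → T → ℝ
  | 0, t => w t ^ (1 - l)
  | m + 1, t => (Fintype.card A : ℝ) ^ (-l) * (open Classical in if P t then Real.exp (l * c) else 1)
      * ∑ a, treeMoment child w P l c m (child t a)

variable {child : T → A → T} {w : T → ℝ} {P : T → Prop} {l c : ℝ}

/-- Hölder over the children: without a reward, one normalised generation does not increase the
moment. -/
lemma card_rpow_mul_sum_le [Nonempty A] (hw : ∀ t, 0 ≤ w t) (hsum : ∀ t, ∑ a, w (child t a) = w t)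
    (h0 : 0 < l) (h1 : l < 1) (t : T) :
    (Fintype.card A : ℝ) ^ (-l) * ∑ a, w (child t a) ^ (1 - l) ≤ w t ^ (1 - l) := by
  have hb : (0 : ℝ) < Fintype.card A := by exact_mod_cast Fintype.card_pos
  have h := holder_sum Finset.univ (fun a => hw (child t a)) h0 h1
  rw [hsum, Finset.card_univ] at h
  calc _ ≤ (Fintype.card A : ℝ) ^ (-l) * (w t ^ (1 - l) * (Fintype.card A : ℝ) ^ l) := by gcongr
    _ = w t ^ (1 - l) * ((Fintype.card A : ℝ) ^ (-l) * (Fintype.card A : ℝ) ^ l) := by ring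
    _ = w t ^ (1 - l) := by rw [← Real.rpow_add hb]; simp

lemma treeMoment_nonneg (hw : ∀ t, 0 ≤ w t) (m : ℕ) (t : T) :
    0 ≤ treeMoment child w P l c m t := by
  induction m generalizing t with
  | zero => exact Real.rpow_nonneg (hw t) _
  | succ m ih =>
    rw [treeMoment]
    have : 0 ≤ ∑ a, treeMoment child w P l c m (child t a) := Finset.sum_nonneg fun a _ => ih _
    split_ifs <;> positivity

lemma treeMoment_le_exp_pow [Nonempty A] (hw : ∀ t, 0 ≤ w t)
    (hsum : ∀ t, ∑ a, w (child t a) = w t) (h0 : 0 < l) (h1 : l < 1) (hc : 0 ≤ c)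
    (m : ℕ) (t : T) :
    treeMoment child w P l c m t ≤ Real.exp (l * c) ^ m * w t ^ (1 - l) := by
  induction m generalizing t with
  | zero => simp [treeMoment]
  | succ m ih =>
    rw [treeMoment]
    have he : 1 ≤ Real.exp (l * c) := Real.one_le_exp (by positivity)
    have hg : (open Classical in if P t then Real.exp (l * c) else 1) ≤ Real.exp (l * c) := by
      split_ifs
      exacts [le_rfl, he]
    have hg0 : 0 ≤ (open Classical in if P t then Real.exp (l * c) else 1) := by
      split_ifs <;> positivity
    set g := (open Classical in if P t then Real.exp (l * c) else 1)
    calc _ ≤ (Fintype.card A : ℝ) ^ (-l) * Real.exp (l * c)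
          * ∑ a, Real.exp (l * c) ^ m * w (child t a) ^ (1 - l) := by
          refine mul_le_mul (by gcongr) (Finset.sum_le_sum fun a _ => ih _)
            (Finset.sum_nonneg fun a _ => treeMoment_nonneg hw m _) (by positivity)
      _ = Real.exp (l * c) ^ (m + 1)
          * ((Fintype.card A : ℝ) ^ (-l) * ∑ a, w (child t a) ^ (1 - l)) := by
          rw [← Finset.mul_sum]; ring
      _ ≤ _ := by
          gcongr
          exact card_rpow_mul_sum_le hw hsum h0 h1 t

/-- Expansion of the moment along a path `v`, with `y` the gain of one generation. -/
lemma treeMoment_le_along_path (hw : ∀ t, 0 ≤ w t)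
    (hsum : ∀ t, ∑ a, w (child t a) = w t) (h0 : 0 < l) (h1 : l < 1) (hc : 0 ≤ c)
    {y : ℝ} (hy : 0 < y) (hyl : (Fintype.card A : ℝ) ^ (-l) * Real.exp (l * c) = y ^ l)
    {C : ℝ} (hC : 0 ≤ C) {M : ℕ}
    (hM : ∀ m, m ≤ M → ∀ t, treeMoment child w P l c m t ≤ C * w t ^ (1 - l))
    (t : T) (v : List A) (m : ℕ) (hm : m + v.length ≤ M + 1) :
    w (v.foldr (fun a u => child u a) t) ≤ w t ∧
    treeMoment child w P l c (m + v.length) t ≤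
      C * ((w t - w (v.foldr (fun a u => child u a) t)) ^ (1 - l)
        * (((Fintype.card A : ℝ) - 1) * ∑ i ∈ Finset.Icc 1 v.length, y ^ i) ^ l)
      + (y ^ v.length) ^ l * treeMoment child w P l c m (v.foldr (fun a u => child u a) t) := by
  classical
  induction v generalizing m with
  | nil => simp [Real.zero_rpow h0.ne']
  | cons a v ih =>
    simp only [List.length_cons] at hm ⊢
    obtain ⟨hle, hJ⟩ := ih (m + 1) (by omega)
    rw [List.foldr_cons]
    set u := v.foldr (fun a u => child u a) t
    have hsplit := Finset.add_sum_erase Finset.univ (fun a' => w (child u a')) (Finset.mem_univ a)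
    rw [hsum] at hsplit
    have hrest : 0 ≤ ∑ a' ∈ Finset.univ.erase a, w (child u a') :=
      Finset.sum_nonneg fun a' _ => hw _
    refine ⟨by linarith, ?_⟩
    have hcard : 1 ≤ Fintype.card A := Fintype.card_pos_iff.2 ⟨a⟩
    have hb1 : (0 : ℝ) ≤ (Fintype.card A : ℝ) - 1 := by
      rw [sub_nonneg]; exact_mod_cast hcard
    have hsib : ∑ a' ∈ Finset.univ.erase a, treeMoment child w P l c m (child u a')
        ≤ C * ((w u - w (child u a)) ^ (1 - l) * ((Fintype.card A : ℝ) - 1) ^ l) := by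
      have h := holder_sum (Finset.univ.erase a) (fun a' => hw (child u a')) h0 h1
      rw [Finset.card_erase_of_mem (Finset.mem_univ a), Finset.card_univ, Nat.cast_sub hcard,
        Nat.cast_one] at h
      have e : ∑ a' ∈ Finset.univ.erase a, w (child u a') = w u - w (child u a) := by linarith
      rw [e] at h
      calc _ ≤ ∑ a' ∈ Finset.univ.erase a, C * w (child u a') ^ (1 - l) :=
            Finset.sum_le_sum fun a' _ => hM m (by omega) _
        _ ≤ _ := by rw [← Finset.mul_sum]; gcongr
    -- Every node of the path is charged the full reward, porous or not; as `c ≥ 0`, this only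
    -- enlarges the bound.
    have hstep : treeMoment child w P l c (m + 1) u ≤ y ^ l *
        (treeMoment child w P l c m (child u a)
          + C * ((w u - w (child u a)) ^ (1 - l) * ((Fintype.card A : ℝ) - 1) ^ l)) := by
      have hs := Finset.add_sum_erase Finset.univ
        (fun a' => treeMoment child w P l c m (child u a')) (Finset.mem_univ a)
      rw [treeMoment, ← hs, ← hyl]
      have hg : (open Classical in if P u then Real.exp (l * c) else 1) ≤ Real.exp (l * c) := by
        split_ifs
        exacts [le_rfl, Real.one_le_exp (by positivity)]
      have hn : 0 ≤ treeMoment child w P l c m (child u a)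
        + ∑ a' ∈ Finset.univ.erase a, treeMoment child w P l c m (child u a') :=
        add_nonneg (treeMoment_nonneg hw _ _)
          (Finset.sum_nonneg fun a' _ => treeMoment_nonneg hw _ _)
      refine mul_le_mul (by gcongr) (by gcongr) hn (by positivity)
    have hYn : 0 ≤ ∑ i ∈ Finset.Icc 1 v.length, y ^ i := Finset.sum_nonneg fun i _ => by positivity
    -- Hölder merges the siblings already split off with those of the new node; the masses telescope
    -- to `w t - w (child u a)`.
    have htwo := holder_two (A := w t - w u) (B := w u - w (child u a))
      (X := ((Fintype.card A : ℝ) - 1) * ∑ i ∈ Finset.Icc 1 v.length, y ^ i)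
      (Y := ((Fintype.card A : ℝ) - 1) * y ^ (v.length + 1))
      (by linarith) (by linarith) (by positivity) (by positivity) h0 h1
    rw [← mul_add, ← Finset.sum_Icc_succ_top (by omega), sub_add_sub_cancel,
      Real.mul_rpow hb1 (by positivity) (y := y ^ (v.length + 1))] at htwo
    have hpow : (y ^ (v.length + 1)) ^ l = (y ^ v.length) ^ l * y ^ l := by
      rw [pow_succ, Real.mul_rpow (by positivity) hy.le]
    rw [hpow] at htwo ⊢
    rw [show m + (v.length + 1) = m + 1 + v.length by omega]
    have h3 := mul_le_mul_of_nonneg_left hstep (by positivity : 0 ≤ (y ^ v.length) ^ l)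
    have h4 := mul_le_mul_of_nonneg_left htwo hC
    linarith

/-- If porous nodes have a descendant of generation `k` of relative weight at most `ε`, the moments
grow at an arbitrarily small exponential rate. -/
lemma treeMoment_le [Nonempty A] (hw : ∀ t, 0 ≤ w t)
    (hsum : ∀ t, ∑ a, w (child t a) = w t) (h0 : 0 < l) (h1 : l < 1) (hc : 0 ≤ c)
    {y : ℝ} (hy : 0 < y) (hyl : (Fintype.card A : ℝ) ^ (-l) * Real.exp (l * c) = y ^ l)
    {k : ℕ} (hk : 1 ≤ k) {ε δ : ℝ} (hδ : 0 ≤ δ)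
    (hP : ∀ t, P t → ∃ v : List A, v.length = k ∧ w (v.foldr (fun a u => child u a) t) ≤ ε * w t)
    (hmoment : ∀ W R : ℝ, 0 ≤ W → 0 ≤ R → R ≤ ε * W →
      (W - R) ^ (1 - l) * (((Fintype.card A : ℝ) - 1) * ∑ i ∈ Finset.Icc 1 k, y ^ i) ^ l
        + R ^ (1 - l) * (y ^ k) ^ l ≤ Real.exp (l * δ) * W ^ (1 - l)) (m : ℕ) (t : T) :
    treeMoment child w P l c m t
      ≤ Real.exp (l * c) ^ k * Real.exp (l * δ) ^ m * w t ^ (1 - l) := by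
  induction m using Nat.strong_induction_on generalizing t with
  | _ m ih =>
    have hD : 1 ≤ Real.exp (l * δ) := Real.one_le_exp (by positivity)
    have hE : 1 ≤ Real.exp (l * c) := Real.one_le_exp (by positivity)
    have hwt : 0 ≤ w t ^ (1 - l) := Real.rpow_nonneg (hw t) _
    -- With fewer than `k` generations left the hole may be out of reach; the crude bound costs the
    -- fixed factor `exp (l * c) ^ k`.
    rcases lt_or_ge m k with hmk | hmk
    · refine (treeMoment_le_exp_pow hw hsum h0 h1 hc m t).trans ?_
      gcongr
      calc Real.exp (l * c) ^ m ≤ Real.exp (l * c) ^ k := pow_le_pow_right₀ hE hmk.le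
        _ ≤ _ := le_mul_of_one_le_right (by positivity) (one_le_pow₀ hD)
    · obtain ⟨M, rfl⟩ : ∃ M, m = M + 1 := ⟨m - 1, by omega⟩
      set C := Real.exp (l * c) ^ k * Real.exp (l * δ) ^ M with hCdef
      have hC : 0 ≤ C := by positivity
      -- One constant serves all smaller generations, so a jump of up to `k` generations pays the
      -- factor `exp (l * δ)` only once.
      have hM : ∀ m, m ≤ M → ∀ t, treeMoment child w P l c m t ≤ C * w t ^ (1 - l) := by
        intro m hm t
        refine (ih m (by omega) t).trans ?_
        have := Real.rpow_nonneg (hw t) (1 - l)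
        rw [hCdef]
        gcongr
      have hgoal : Real.exp (l * c) ^ k * Real.exp (l * δ) ^ (M + 1) = C * Real.exp (l * δ) := by
        rw [hCdef]; ring
      rw [hgoal, mul_assoc]
      by_cases hp : P t
      · obtain ⟨v, hv, hvε⟩ := hP t hp
        obtain ⟨hle, h⟩ := treeMoment_le_along_path hw hsum h0 h1 hc hy hyl hC hM t v
          (M + 1 - k) (by omega)
        rw [hv, show M + 1 - k + k = M + 1 by omega] at h
        refine h.trans ?_
        have h2 := hmoment (w t) _ (hw t) (hw _) hvε
        have h3 := hM (M + 1 - k) (by omega) (v.foldr (fun a u => child u a) t)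
        have h4 := mul_le_mul_of_nonneg_left h2 hC
        have h5 := mul_le_mul_of_nonneg_left h3 (by positivity : 0 ≤ (y ^ k) ^ l)
        linarith
      · rw [treeMoment, if_neg hp, mul_one]
        calc _ ≤ (Fintype.card A : ℝ) ^ (-l) * ∑ a, C * w (child t a) ^ (1 - l) := by
              gcongr with a
              exact hM M le_rfl _
          _ = C * ((Fintype.card A : ℝ) ^ (-l) * ∑ a, w (child t a) ^ (1 - l)) := by
              rw [← Finset.mul_sum]; ring
          _ ≤ C * w t ^ (1 - l) := by
              gcongr
              exact card_rpow_mul_sum_le hw hsum h0 h1 t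
          _ ≤ _ := by
              gcongr
              exact le_mul_of_one_le_left hwt hD

end Tree

/-! ### Dyadic cubes as a tree, holes and the almost sure estimate -/

section Cubes

variable {d : ℕ}

/-- The index of the dyadic cube of level `n` that contains `x`. -/
def cubeIndex (n : ℕ) (x : EuclideanSpace ℝ (Fin d)) : Fin d → ℤ := fun i => ⌊(2 : ℝ) ^ n * x i⌋

lemma cubeAt_eq (n : ℕ) (x : EuclideanSpace ℝ (Fin d)) :
    cubeAt n x = dyadicCube n (cubeIndex n x) := rfl

lemma mem_dyadicCube_iff {n : ℕ} {m : Fin d → ℤ} {y : EuclideanSpace ℝ (Fin d)} :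
    y ∈ dyadicCube n m ↔ cubeIndex n y = m := by
  have h2 : (0 : ℝ) < 2 ^ n := by positivity
  simp only [dyadicCube, Set.mem_ofPred_eq, cubeIndex, funext_iff, Int.floor_eq_iff,
    div_le_iff₀ h2, lt_div_iff₀ h2, mul_comm ((2 : ℝ) ^ n)]

lemma mem_cubeAt (n : ℕ) (x : EuclideanSpace ℝ (Fin d)) : x ∈ cubeAt n x :=
  mem_dyadicCube_iff.2 rfl

lemma unitCube_eq : unitCube d = dyadicCube 0 0 := by
  ext y
  simp [unitCube, dyadicCube]

lemma measurable_cubeIndex (n : ℕ) : Measurable (cubeIndex (d := d) n) := by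
  refine measurable_pi_iff.2 fun i => Int.measurable_floor.comp ?_
  fun_prop

lemma measurable_comp_cubeIndex {β : Type*} [MeasurableSpace β] (n : ℕ) (f : (Fin d → ℤ) → β) :
    Measurable fun x => f (cubeIndex n x) :=
  (measurable_of_countable f).comp (measurable_cubeIndex n)

lemma measurableSet_dyadicCube (n : ℕ) (m : Fin d → ℤ) : MeasurableSet (dyadicCube n m) := by
  have : dyadicCube n m = cubeIndex n ⁻¹' {m} := by
    ext y
    exact mem_dyadicCube_iff
  rw [this]
  exact measurable_cubeIndex n (MeasurableSet.singleton m)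

/-- The children of a dyadic cube; cubes are coded by level and index. -/
def childCube (t : ℕ × (Fin d → ℤ)) (a : Fin d → Fin 2) : ℕ × (Fin d → ℤ) :=
  (t.1 + 1, fun i => 2 * t.2 i + ((a i : ℕ) : ℤ))

lemma childCube_injective (t : ℕ × (Fin d → ℤ)) : Function.Injective (childCube t) := by
  intro a b h
  funext i
  have := congrFun (congrArg Prod.snd h) i
  simp only [childCube] at this
  exact Fin.ext (by omega)

/-- The code of the cube of level `n` that contains `x`. -/
def nodeAt (n : ℕ) (x : EuclideanSpace ℝ (Fin d)) : ℕ × (Fin d → ℤ) := (n, cubeIndex n x)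

lemma exists_childCube_eq (n : ℕ) (x : EuclideanSpace ℝ (Fin d)) :
    ∃ a, childCube (nodeAt n x) a = nodeAt (n + 1) x := by
  have key : ∀ i, 2 * cubeIndex n x i ≤ cubeIndex (n + 1) x i ∧
      cubeIndex (n + 1) x i < 2 * cubeIndex n x i + 2 := by
    intro i
    have e : (2 : ℝ) ^ (n + 1) * x i = 2 * (2 ^ n * x i) := by ring
    simp only [cubeIndex, e]
    have h1 := Int.floor_le ((2 : ℝ) ^ n * x i)
    have h2 := Int.lt_floor_add_one ((2 : ℝ) ^ n * x i)
    constructor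
    · rw [Int.le_floor]
      push_cast
      linarith
    · rw [Int.floor_lt]
      push_cast
      linarith
  refine ⟨fun i => ⟨(cubeIndex (n + 1) x i - 2 * cubeIndex n x i).toNat, ?_⟩, ?_⟩
  · have := key i
    omega
  · refine Prod.ext rfl (funext fun i => ?_)
    have := key i
    simp only [childCube, nodeAt]
    omega

lemma exists_path_nodeAt (n k : ℕ) (x : EuclideanSpace ℝ (Fin d)) :
    ∃ v : List (Fin d → Fin 2), v.length = k ∧
      v.foldr (fun a u => childCube u a) (nodeAt n x) = nodeAt (n + k) x := by
  induction k with
  | zero => exact ⟨[], rfl, rfl⟩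
  | succ k ih =>
    obtain ⟨v, hv, h⟩ := ih
    obtain ⟨a, ha⟩ := exists_childCube_eq (n + k) x
    exact ⟨a :: v, by simp [hv], by rw [List.foldr_cons, h, ha]; rfl⟩

/-- The cube with code `t`. -/
def nodeCube (t : ℕ × (Fin d → ℤ)) : Set (EuclideanSpace ℝ (Fin d)) := dyadicCube t.1 t.2

lemma mem_nodeCube_iff {t : ℕ × (Fin d → ℤ)} {x : EuclideanSpace ℝ (Fin d)} :
    x ∈ nodeCube t ↔ nodeAt t.1 x = t := by
  rw [nodeCube, mem_dyadicCube_iff, nodeAt, Prod.ext_iff]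
  simp

lemma nodeAt_eq_of_succ {n : ℕ} {x y : EuclideanSpace ℝ (Fin d)}
    (h : nodeAt (n + 1) x = nodeAt (n + 1) y) : nodeAt n x = nodeAt n y := by
  obtain ⟨a, ha⟩ := exists_childCube_eq n x
  obtain ⟨b, hb⟩ := exists_childCube_eq n y
  rw [← ha, ← hb] at h
  refine Prod.ext rfl (funext fun i => ?_)
  have := congrFun (congrArg Prod.snd h) i
  simp only [childCube] at this
  omega

lemma nodeCube_eq_iUnion (t : ℕ × (Fin d → ℤ)) : nodeCube t = ⋃ a, nodeCube (childCube t a) := by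
  ext x
  simp only [Set.mem_iUnion, mem_nodeCube_iff]
  constructor
  · intro h
    obtain ⟨a, ha⟩ := exists_childCube_eq t.1 x
    rw [h] at ha
    exact ⟨a, ha ▸ rfl⟩
  · rintro ⟨a, ha⟩
    obtain ⟨b, hb⟩ := exists_childCube_eq t.1 x
    have h : childCube (nodeAt t.1 x) b = childCube t a := hb.trans ha
    refine Prod.ext rfl (funext fun i => ?_)
    have := congrFun (congrArg Prod.snd h) i
    simp only [childCube] at this
    omega

lemma pairwise_disjoint_nodeCube (t : ℕ × (Fin d → ℤ)) :
    Pairwise (Function.onFun Disjoint fun a => nodeCube (childCube t a)) := by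
  intro a b hab
  refine Set.disjoint_left.2 fun x hx hy => hab (childCube_injective t ?_)
  rw [mem_nodeCube_iff] at hx hy
  exact hx.symm.trans hy

lemma measurableSet_nodeCube (t : ℕ × (Fin d → ℤ)) : MeasurableSet (nodeCube t) :=
  measurableSet_dyadicCube _ _

variable (μ : Measure (EuclideanSpace ℝ (Fin d)))

lemma sum_measureReal_childCube [IsProbabilityMeasure μ] (t : ℕ × (Fin d → ℤ)) :
    ∑ a, μ.real (nodeCube (childCube t a)) = μ.real (nodeCube t) := by
  rw [nodeCube_eq_iUnion t, measureReal_iUnion_fintype (pairwise_disjoint_nodeCube t)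
    fun a => measurableSet_nodeCube _]

/-- The cube with code `t` has a descendant of generation `k` of relative measure at most `ε`. -/
def HasHole (k : ℕ) (ε : ℝ) (t : ℕ × (Fin d → ℤ)) : Prop :=
  ∃ v : List (Fin d → Fin 2), v.length = k ∧
    μ.real (nodeCube (v.foldr (fun a u => childCube u a) t)) ≤ ε * μ.real (nodeCube t)

lemma cubeAt_antitone (x : EuclideanSpace ℝ (Fin d)) : Antitone fun n => cubeAt n x := by
  refine antitone_nat_of_succ_le fun n y hy => ?_
  rw [cubeAt_eq, mem_dyadicCube_iff] at hy ⊢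
  exact congrArg Prod.snd (nodeAt_eq_of_succ (show nodeAt (n + 1) y = nodeAt (n + 1) x from
    Prod.ext rfl hy))

/-- A hole of relative depth `j ≤ k` is refined to depth exactly `k` by following any of its points;
passing to a subcube does not increase the measure. -/
lemma hasHole_of_por2_le [IsProbabilityMeasure μ] {k n : ℕ} {ε : ℝ} {x : EuclideanSpace ℝ (Fin d)}
    (h : por2 μ x n ε ≤ k) : HasHole μ k ε (nodeAt n x) := by
  unfold por2 at h
  set S := {j : ℕ∞ | ∃ k : ℕ, 1 ≤ k ∧ j = (k : ℕ∞) ∧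
    ∃ R ∈ subCubes n k (cubeAt n x), μ.real R / μ.real (cubeAt n x) ≤ ε} with hS
  have hne : S.Nonempty := by
    rw [Set.nonempty_iff_ne_empty]
    intro h0
    rw [h0, sInf_empty] at h
    exact absurd h (by simp)
  obtain ⟨j, -, hj, R, ⟨⟨⟨m, rfl⟩, -⟩, hRQ⟩, hR⟩ := csInf_mem hne
  rw [hj, Nat.cast_le] at h
  have hy : ∃ y : EuclideanSpace ℝ (Fin d), y ∈ dyadicCube (n + j) m := by
    refine ⟨WithLp.toLp 2 fun i => (m i : ℝ) / 2 ^ (n + j), fun i => ⟨le_rfl, ?_⟩⟩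
    exact div_lt_div_of_pos_right (by simp) (by positivity)
  obtain ⟨y, hy⟩ := hy
  have hyx : nodeAt n y = nodeAt n x := Prod.ext rfl (mem_dyadicCube_iff.1 (hRQ hy))
  obtain ⟨v, hv, hvy⟩ := exists_path_nodeAt n k y
  refine ⟨v, hv, ?_⟩
  rw [← hyx, hvy]
  have hQ : nodeCube (nodeAt n y) = cubeAt n x := by rw [hyx]; rfl
  have hsub : nodeCube (nodeAt (n + k) y) ⊆ dyadicCube (n + j) m := by
    rw [← mem_dyadicCube_iff.1 hy]
    exact cubeAt_antitone y (show n + j ≤ n + k by omega)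
  have hle : μ.real (nodeCube (nodeAt (n + k) y)) ≤ μ.real (dyadicCube (n + j) m) :=
    measureReal_mono hsub
  rw [hQ]
  -- In a null cube the quotient in `por2` is `0` by convention, so the product form is proved
  -- separately: every subcube is null.
  rcases (measureReal_nonneg (μ := μ) (s := cubeAt n x)).eq_or_lt with h0 | h0
  · rw [← h0, mul_zero]
    exact h0 ▸ hle.trans (measureReal_mono hRQ)
  · exact hle.trans ((div_le_iff₀ h0).1 hR)

open Classical in
/-- The random variable whose integral over a cube is a `treeMoment`. -/
def cubeMoment (k : ℕ) (ε l c : ℝ) (m n : ℕ) (x : EuclideanSpace ℝ (Fin d)) : ℝ :=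
  (∏ i ∈ Finset.range m, ((Fintype.card (Fin d → Fin 2) : ℝ) ^ (-l)
    * (if HasHole μ k ε (nodeAt (n + i) x) then Real.exp (l * c) else 1)))
    * μ.real (nodeCube (nodeAt (n + m) x)) ^ (-l)

lemma measurable_cubeMoment (k : ℕ) (ε l c : ℝ) (m n : ℕ) :
    Measurable (cubeMoment μ k ε l c m n) := by
  classical
  refine Measurable.mul (Finset.measurable_fun_prod _ fun i _ => ?_) ?_
  · exact measurable_comp_cubeIndex (n + i) fun q => (Fintype.card (Fin d → Fin 2) : ℝ) ^ (-l)
      * (if HasHole μ k ε (n + i, q) then Real.exp (l * c) else 1)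
  · exact measurable_comp_cubeIndex (n + m) fun q => μ.real (nodeCube (n + m, q)) ^ (-l)

/-- Integrating `μ(Q) ^ (-l)` over `Q` yields `μ(Q) ^ (1 - l)`, and the factor of the top cube is
constant on it, so the integral obeys the recursion of `treeMoment`. -/
lemma setLIntegral_cubeMoment_le [IsProbabilityMeasure μ] (k : ℕ) (ε l c : ℝ) (m : ℕ) (t : ℕ × (Fin d → ℤ)) :
    ∫⁻ x in nodeCube t, ENNReal.ofReal (cubeMoment μ k ε l c m t.1 x) ∂μ
      ≤ ENNReal.ofReal
        (treeMoment childCube (fun t => μ.real (nodeCube t)) (HasHole μ k ε) l c m t) := by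
  classical
  induction m generalizing t with
  | zero =>
    have h : ∀ x ∈ nodeCube t, ENNReal.ofReal (cubeMoment μ k ε l c 0 t.1 x)
        = ENNReal.ofReal (μ.real (nodeCube t) ^ (-l)) := by
      intro x hx
      simp [cubeMoment, mem_nodeCube_iff.1 hx]
    rw [setLIntegral_congr_fun (measurableSet_nodeCube t) h, setLIntegral_const, treeMoment,
      ← ofReal_measureReal, ← ENNReal.ofReal_mul (by positivity)]
    refine ENNReal.ofReal_le_ofReal ?_
    rcases (measureReal_nonneg (μ := μ) (s := nodeCube t)).eq_or_lt with h0 | h0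
    · rw [← h0, mul_zero]
      positivity
    · rw [sub_eq_neg_add, Real.rpow_add h0, Real.rpow_one]
  | succ m ih =>
    have hg : 0 ≤ (Fintype.card (Fin d → Fin 2) : ℝ) ^ (-l)
        * (if HasHole μ k ε t then Real.exp (l * c) else 1) := by
      split_ifs <;> positivity
    have h : ∀ x ∈ nodeCube t, ENNReal.ofReal (cubeMoment μ k ε l c (m + 1) t.1 x)
        = ENNReal.ofReal ((Fintype.card (Fin d → Fin 2) : ℝ) ^ (-l)
          * (if HasHole μ k ε t then Real.exp (l * c) else 1))
          * ENNReal.ofReal (cubeMoment μ k ε l c m (t.1 + 1) x) := by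
      intro x hx
      rw [← ENNReal.ofReal_mul hg]
      congr 1
      unfold cubeMoment
      rw [Finset.prod_range_succ']
      simp only [add_zero, mem_nodeCube_iff.1 hx, add_assoc, add_comm 1]
      ring
    rw [setLIntegral_congr_fun (measurableSet_nodeCube t) h,
      lintegral_const_mul' _ _ ENNReal.ofReal_ne_top, treeMoment, ENNReal.ofReal_mul hg]
    gcongr
    rw [nodeCube_eq_iUnion t, lintegral_iUnion (fun a => measurableSet_nodeCube _)
      (pairwise_disjoint_nodeCube t), tsum_fintype, ENNReal.ofReal_sum_of_nonneg
      fun a _ => treeMoment_nonneg (fun _ => measureReal_nonneg) _ _]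
    exact Finset.sum_le_sum fun a _ => ih (childCube t a)

lemma ae_measureReal_cubeAt_pos [IsProbabilityMeasure μ] : ∀ᵐ x ∂μ, ∀ n, 0 < μ.real (cubeAt n x) := by
  refine ae_all_iff.2 fun n => ?_
  have h : ∀ᵐ x ∂μ, ∀ m, cubeIndex n x = m → μ.real (dyadicCube n m) ≠ 0 := by
    refine ae_all_iff.2 fun m => ?_
    by_cases h0 : μ.real (dyadicCube n m) = 0
    · rw [measureReal_eq_zero_iff] at h0
      filter_upwards [measure_eq_zero_iff_ae_notMem.1 h0] with x hx hm
      exact absurd (mem_dyadicCube_iff.2 hm) hx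
    · exact Eventually.of_forall fun x _ => h0
  filter_upwards [h] with x hx
  exact measureReal_nonneg.lt_of_ne' (hx _ rfl)

/-- The key almost sure estimate: every porous scale saves `tDrop d k ε * log 2`. -/
lemma ae_eventually_neg_log_le [IsProbabilityMeasure μ] {k : ℕ} (hd : 1 ≤ d) (hk : 1 ≤ k) {ε : ℝ}
    (hε : ε ∈ Set.Icc (0 : ℝ) (1 / 2 ^ (k * d))) (hμ : μ (unitCube d)ᶜ = 0) {δ : ℝ} (hδ : 0 < δ) :
    open Classical in ∀ᵐ x ∂μ, ∀ᶠ n : ℕ in atTop,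
      -Real.log (μ.real (cubeAt n x)) ≤ n * (d * Real.log 2) + n * δ - tDrop d k ε * Real.log 2
        * (((Finset.range n).filter (fun i => por2 μ x i ε ≤ (k : ℕ∞))).card : ℝ) := by
  classical
  obtain ⟨l, hl0, hl1, hmoment⟩ := exists_hole_moment_le hd hk hε (half_pos hδ)
  have hl2 : 0 < Real.log 2 := Real.log_pos (by norm_num)
  have htd : 0 ≤ tDrop d k ε := by
    rw [tDrop]
    linarith [(setOf_rootEquation hd hk hε).2]
  set c := tDrop d k ε * Real.log 2 with hc
  have hc0 : 0 ≤ c := by positivity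
  set y : ℝ := (2 : ℝ) ^ (-sRoot d k ε) with hy
  have hcard : (Fintype.card (Fin d → Fin 2) : ℝ) = 2 ^ d := by simp
  have hypow : ∀ i : ℕ, (2 : ℝ) ^ (-(sRoot d k ε * (i : ℝ))) = y ^ i := by
    intro i
    rw [hy, ← neg_mul, Real.rpow_mul_natCast (by norm_num)]
  -- The reward `c = (d - s) * log 2` is chosen so that normalisation and reward combine to `2 ^ (-s
  -- l)` per generation.
  have hyl : (Fintype.card (Fin d → Fin 2) : ℝ) ^ (-l) * Real.exp (l * c) = y ^ l := by
    rw [hcard, hy, hc, tDrop, ← Real.rpow_natCast, ← Real.rpow_mul (by norm_num),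
      ← Real.rpow_mul (by norm_num), Real.rpow_def_of_pos (by norm_num),
      Real.rpow_def_of_pos (by norm_num), ← Real.exp_add]
    congr 1
    ring
  have hJ := treeMoment_le (child := childCube) (w := fun t => μ.real (nodeCube t))
    (P := HasHole μ k ε) (fun _ => measureReal_nonneg) (sum_measureReal_childCube μ) hl0 hl1 hc0
    (y := y) (by positivity) hyl hk (half_pos hδ).le (ε := ε) (fun t ht => ht)
    (by
      intro W R hW hR hRW
      have h := hmoment W R hW hR hRW
      simp only [holeWeight, hypow] at h
      rw [hcard]
      exact h)
  set C := Real.exp (l * c) ^ k with hC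
  have hint : ∀ n, ∫⁻ x, ENNReal.ofReal (cubeMoment μ k ε l c n 0 x) ∂μ
      ≤ ENNReal.ofReal (C * Real.exp (l * (δ / 2)) ^ n) := by
    intro n
    have hres : μ.restrict (nodeCube (0, 0)) = μ := by
      refine Measure.restrict_eq_self_of_ae_mem ?_
      rw [nodeCube, ← unitCube_eq]
      exact measure_eq_zero_iff_ae_notMem.1 hμ |>.mono fun x hx => not_not.1 hx
    have h := setLIntegral_cubeMoment_le μ k ε l c n (0, 0)
    rw [hres] at h
    refine h.trans (ENNReal.ofReal_le_ofReal ((hJ n (0, 0)).trans ?_))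
    exact mul_le_of_le_one_right (by positivity)
      (Real.rpow_le_one measureReal_nonneg measureReal_le_one (by linarith))
  have hq : Real.exp (-(l * (δ / 2))) < 1 := by
    rw [Real.exp_lt_one_iff, neg_lt_zero]
    positivity
  -- The moments grow at rate `δ / 2` and the threshold at rate `δ`, so the exceptional measures are
  -- summable.
  have hmarkov : ∀ n, μ {x | ENNReal.ofReal (Real.exp (l * δ) ^ n)
      ≤ ENNReal.ofReal (cubeMoment μ k ε l c n 0 x)}
      ≤ ENNReal.ofReal (C * Real.exp (-(l * (δ / 2))) ^ n) := by
    intro n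
    refine (meas_ge_le_lintegral_div
      (measurable_cubeMoment μ k ε l c n 0).ennreal_ofReal.aemeasurable
      (by simpa using by positivity) ENNReal.ofReal_ne_top).trans ?_
    refine (ENNReal.div_le_div_right (hint n) _).trans ?_
    rw [← ENNReal.ofReal_div_of_pos (by positivity), mul_div_assoc, ← div_pow, ← Real.exp_sub]
    refine le_of_eq ?_
    congr 4
    ring
  have hsum : ∑' n, μ {x | ENNReal.ofReal (Real.exp (l * δ) ^ n)
      ≤ ENNReal.ofReal (cubeMoment μ k ε l c n 0 x)} ≠ ⊤ := by
    refine ne_top_of_le_ne_top ?_ (ENNReal.tsum_le_tsum hmarkov)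
    exact ((summable_geometric_of_lt_one (Real.exp_pos _).le hq).mul_left C).tsum_ofReal_ne_top
  filter_upwards [ae_eventually_notMem hsum, ae_measureReal_cubeAt_pos μ] with x hx hpos
  filter_upwards [hx] with n hn
  simp only [not_le] at hn
  have hlt := (ENNReal.ofReal_lt_ofReal_iff (by positivity)).1 hn
  have hform : cubeMoment μ k ε l c n 0 x = ((2 : ℝ) ^ d) ^ (-l * n)
      * Real.exp (l * c * (((Finset.range n).filter
        (fun i => HasHole μ k ε (nodeAt i x))).card : ℝ)) * μ.real (cubeAt n x) ^ (-l) := by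
    unfold cubeMoment
    rw [Finset.prod_mul_distrib, Finset.prod_const, Finset.card_range, Finset.prod_ite,
      Finset.prod_const, Finset.prod_const_one, mul_one, hcard, ← Real.exp_nat_mul,
      Real.rpow_mul_natCast (by positivity)]
    simp only [zero_add]
    rw [mul_comm (l * c)]
    rfl
  have hmono : (((Finset.range n).filter (fun i => por2 μ x i ε ≤ (k : ℕ∞))).card : ℝ)
      ≤ (((Finset.range n).filter (fun i => HasHole μ k ε (nodeAt i x))).card : ℝ) := by
    exact_mod_cast Finset.card_le_card
      (Finset.monotone_filter_right _ fun i _ h => hasHole_of_por2_le μ h)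
  have hw := hpos n
  have hlog : Real.log (cubeMoment μ k ε l c n 0 x) < n * (l * δ) := by
    rw [← Real.log_exp (n * (l * δ)), Real.exp_nat_mul]
    refine Real.log_lt_log ?_ hlt
    rw [hform]
    positivity
  rw [hform, Real.log_mul (by positivity) (by positivity), Real.log_mul (by positivity)
    (by positivity), Real.log_exp, Real.log_rpow (by positivity), Real.log_rpow hw,
    Real.log_pow] at hlog
  -- Every term of the logarithm carries a factor `l`, which cancels; the size of `l` therefore
  -- leaves no trace in the estimate.
  have h3 : l * (-Real.log (μ.real (cubeAt n x)) - (n * (d * Real.log 2) + n * δ - c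
      * (((Finset.range n).filter (fun i => HasHole μ k ε (nodeAt i x))).card : ℝ))) < l * 0 := by
    linarith
  have h4 := lt_of_mul_lt_mul_left h3 hl0.le
  have h5 := mul_le_mul_of_nonneg_left hmono hc0
  linarith

end Cubes

/-! ### From cubes to balls: local and packing dimension -/

section Balls

variable {d : ℕ}

lemma cubeAt_subset_closedBall (hd : 1 ≤ d) {n : ℕ} {x : EuclideanSpace ℝ (Fin d)} {r : ℝ}
    (hr : (d : ℝ) / 2 ^ n ≤ r) : cubeAt n x ⊆ Metric.closedBall x r := by
  intro y hy
  have hx := mem_cubeAt n x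
  rw [Metric.mem_closedBall]
  refine le_trans ?_ hr
  rw [EuclideanSpace.dist_eq, Real.sqrt_le_left (by positivity)]
  have hd' : (1 : ℝ) ≤ d := by exact_mod_cast hd
  have hi : ∀ i ∈ Finset.univ, dist (y i) (x i) ^ 2 ≤ (1 / 2 ^ n : ℝ) ^ 2 := by
    intro i _
    refine pow_le_pow_left₀ dist_nonneg ?_ 2
    have h1 := hx i
    have h2 := hy i
    rw [add_div] at h1 h2
    rw [Real.dist_eq, abs_le]
    constructor <;> linarith [h1.1, h1.2, h2.1, h2.2]
  calc _ ≤ ∑ _i : Fin d, (1 / 2 ^ n : ℝ) ^ 2 := Finset.sum_le_sum hi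
    _ = d * (1 / 2 ^ n : ℝ) ^ 2 := by simp
    _ ≤ (d * d) * (1 / 2 ^ n : ℝ) ^ 2 := by gcongr; nlinarith
    _ = (d / 2 ^ n : ℝ) ^ 2 := by ring

/-- A level whose cubes have diameter at most `r`. -/
def scaleLevel (d : ℕ) (r : ℝ) : ℕ := ⌈Real.logb 2 (d / r)⌉₊

lemma div_two_pow_scaleLevel_le (hd : 1 ≤ d) {r : ℝ} (hr : 0 < r) :
    (d : ℝ) / 2 ^ scaleLevel d r ≤ r := by
  have hd' : (0 : ℝ) < d := by exact_mod_cast hd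
  rw [div_le_iff₀ (by positivity), ← div_le_iff₀' hr, ← Real.rpow_natCast,
    ← Real.logb_le_iff_le_rpow (by norm_num) (by positivity)]
  exact Nat.le_ceil _

lemma tendsto_log_div_nhdsGT_zero (hd : 1 ≤ d) :
    Tendsto (fun r : ℝ => Real.logb 2 (d / r)) (𝓝[>] 0) atTop := by
  have hd' : (0 : ℝ) < d := by exact_mod_cast hd
  refine (Real.tendsto_logb_atTop (by norm_num)).comp ?_
  exact (tendsto_inv_nhdsGT_zero.const_mul_atTop hd').congr fun r => (div_eq_mul_inv _ r).symm

lemma tendsto_scaleLevel_mul_log_div (hd : 1 ≤ d) :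
    Tendsto (fun r => (scaleLevel d r : ℝ) * Real.log 2 / -Real.log r) (𝓝[>] 0) (𝓝 1) := by
  have hd' : (1 : ℝ) ≤ d := by exact_mod_cast hd
  have hl2 : 0 < Real.log 2 := Real.log_pos (by norm_num)
  have hneg : Tendsto (fun r => -Real.log r) (𝓝[>] 0) atTop :=
    tendsto_neg_atBot_atTop.comp Real.tendsto_log_nhdsGT_zero
  have hlim : ∀ b : ℝ, Tendsto (fun r => 1 + b / -Real.log r) (𝓝[>] 0) (𝓝 1) := fun b => by
    simpa using (hneg.const_div_atTop b).const_add 1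
  refine tendsto_of_tendsto_of_tendsto_of_le_of_le' (hlim (Real.log d))
    (hlim (Real.log d + Real.log 2)) ?_ ?_
  all_goals
    filter_upwards [self_mem_nhdsWithin, eventually_nhdsWithin_of_eventually_nhds
      (gt_mem_nhds one_pos)] with r hr0 hr1
    have hr0 : 0 < r := hr0
    have hlog : 0 < -Real.log r := neg_pos.2 (Real.log_neg hr0 hr1)
    have e : Real.logb 2 (d / r) * Real.log 2 = Real.log d + -Real.log r := by
      rw [Real.logb, div_mul_cancel₀ _ hl2.ne', Real.log_div (by linarith) hr0.ne', sub_eq_add_neg]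
    have hnn : 0 ≤ Real.logb 2 (d / r) :=
      Real.logb_nonneg (by norm_num) ((one_le_div hr0).2 (by linarith))
    rw [one_add_div hlog.ne', div_le_div_iff_of_pos_right hlog]
  · have := mul_le_mul_of_nonneg_right (Nat.le_ceil (Real.logb 2 (d / r))) hl2.le
    rw [scaleLevel]
    linarith
  · have := mul_le_mul_of_nonneg_right (Nat.ceil_lt_add_one hnn).le hl2.le
    rw [scaleLevel]
    linarith

variable {μ : Measure (EuclideanSpace ℝ (Fin d))}

/-- Only a lower bound for ball masses is needed, so one cube inside the ball suffices, at a level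
asymptotic to `-log r / log 2`. Dividing by `log r < 0` reverses the inequality. -/
lemma upperLocalDim_le [IsProbabilityMeasure μ] (hd : 1 ≤ d) {x : EuclideanSpace ℝ (Fin d)}
    (hpos : ∀ n, 0 < μ.real (cubeAt n x)) {c : ℝ}
    (h : ∀ᶠ n : ℕ in atTop, -Real.log (μ.real (cubeAt n x)) ≤ n * (c * Real.log 2)) :
    upperLocalDim μ x ≤ (c : EReal) := by
  have htop : Tendsto (scaleLevel d) (𝓝[>] 0) atTop :=
    tendsto_nat_ceil_atTop.comp (tendsto_log_div_nhdsGT_zero hd)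
  have hlim : Tendsto (fun r => (((scaleLevel d r : ℝ) * Real.log 2 / -Real.log r * c : ℝ) : EReal))
      (𝓝[>] 0) (𝓝 (c : EReal)) := by
    have := (tendsto_scaleLevel_mul_log_div hd).mul_const c
    rw [one_mul] at this
    exact (continuous_coe_real_ereal.tendsto c).comp this
  rw [← hlim.limsup_eq]
  refine limsup_le_limsup ?_
  filter_upwards [htop.eventually h, self_mem_nhdsWithin,
    eventually_nhdsWithin_of_eventually_nhds (gt_mem_nhds one_pos)] with r hr hr0 hr1
  have hr0 : 0 < r := hr0
  have hlog : Real.log r < 0 := Real.log_neg hr0 hr1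
  have hsub := cubeAt_subset_closedBall (x := x) hd (div_two_pow_scaleLevel_le hd hr0)
  have hle := ENNReal.log_monotone (measure_mono (μ := μ) hsub)
  rw [ENNReal.log_pos_real' (hpos (scaleLevel d r))] at hle
  refine (EReal.div_le_div_right_of_nonpos (by exact_mod_cast hlog.le) hle).trans ?_
  rw [← EReal.coe_div, EReal.coe_le_coe_iff, ← neg_div_neg_eq, div_mul_eq_mul_div,
    div_le_div_iff_of_pos_right (neg_pos.2 hlog)]
  change -Real.log (μ.real _) ≤ _
  linarith

lemma packingDim_le {k : ℕ} (hd : 1 ≤ d) (hk : 1 ≤ k) {ε η : ℝ}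
    (hε : ε ∈ Set.Icc (0 : ℝ) (1 / 2 ^ (k * d))) [IsProbabilityMeasure μ]
    (hμ : μ (unitCube d)ᶜ = 0) (hpor : IsDyadicMeanPorous k η ε μ) :
    packingDim μ ≤ (((d : ℝ) - η * tDrop d k ε : ℝ) : EReal) := by
  classical
  refine essSup_le_of_ae_le _ ?_
  -- The exceptional null set depends on the error, hence the restriction to countably many errors
  -- `1 / (j + 1)`.
  have hall : ∀ j : ℕ, ∀ᵐ x ∂μ, ∀ᶠ n : ℕ in atTop,
      -Real.log (μ.real (cubeAt n x)) ≤ n * (d * Real.log 2) + n * (1 / ((j : ℝ) + 1))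
        - tDrop d k ε * Real.log 2
          * (((Finset.range n).filter (fun i => por2 μ x i ε ≤ (k : ℕ∞))).card : ℝ) := fun j =>
    ae_eventually_neg_log_le μ hd hk hε hμ Nat.one_div_pos_of_nat
  have hl2 : 0 < Real.log 2 := Real.log_pos (by norm_num)
  have htd : 0 ≤ tDrop d k ε := by
    rw [tDrop]
    linarith [(setOf_rootEquation hd hk hε).2]
  filter_upwards [ae_all_iff.2 hall, ae_measureReal_cubeAt_pos μ, hpor] with x hx hpos hη
  refine EReal.le_of_forall_lt_iff_le.1 fun z hz => ?_
  rw [EReal.coe_lt_coe_iff] at hz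
  set g := z - (d - η * tDrop d k ε) with hg
  have hg0 : 0 < g := by linarith
  obtain ⟨j, hj⟩ := exists_nat_one_div_lt (show 0 < g / 2 * Real.log 2 by positivity)
  -- Half of the slack `g` covers the error `1 / (j + 1)`, half the loss from `η` to `η'`; adding
  -- `1` keeps the denominator positive when the drop vanishes.
  set η' := η - g / 2 / (tDrop d k ε + 1) with hη'
  have hη'lt : η' < η := by
    rw [hη', sub_lt_self_iff]
    positivity
  have hcost : tDrop d k ε * (η - η') ≤ g / 2 := by
    rw [hη', sub_sub_cancel, mul_div_assoc', div_le_iff₀ (by positivity)]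
    nlinarith
  have hfreq := eventually_lt_of_lt_liminf (hη'lt.trans_le hη)
    (isBoundedUnder_of ⟨0, fun n => by positivity⟩)
  refine upperLocalDim_le hd hpos ?_
  filter_upwards [hx j, hfreq, eventually_gt_atTop 0] with n hn hf hn0
  have hn0 : (0 : ℝ) < n := by exact_mod_cast hn0
  rw [lt_div_iff₀ hn0] at hf
  have h1 := mul_le_mul_of_nonneg_left hf.le (mul_nonneg htd hl2.le)
  have h2 := mul_le_mul_of_nonneg_left hj.le hn0.le
  have h3 := mul_le_mul_of_nonneg_left hcost (mul_nonneg hn0.le hl2.le)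
  have hz' : z = g + d - η * tDrop d k ε := by rw [hg]; ring
  rw [hz']
  linarith

end Balls

end

end DyadicPorosity

theorem theorem4p1 (d k : ℕ) (hd : 1 ≤ d) (hk : 1 ≤ k) :
    (∀ ε ∈ Set.Icc (0 : ℝ) (1 / 2 ^ (k * d)),
      IsGreatest {s : ℝ | DyadicPorosity.RootEquation d k ε s} (DyadicPorosity.sRoot d k ε) ∧
      ∀ η ∈ Set.Ioc (0 : ℝ) 1,
        ∀ (μ : MeasureTheory.Measure (EuclideanSpace ℝ (Fin d)))
          [MeasureTheory.IsProbabilityMeasure μ],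
          μ (DyadicPorosity.unitCube d)ᶜ = 0 →
          DyadicPorosity.IsDyadicMeanPorous k η ε μ →
          DyadicPorosity.packingDim μ ≤
            (((d : ℝ) - η * DyadicPorosity.tDrop d k ε : ℝ) : EReal)) ∧
    (∀ ε ∈ Set.Ico (0 : ℝ) (1 / 2 ^ (k * d)), 0 < DyadicPorosity.tDrop d k ε) ∧
    (∃ δ > (0 : ℝ), ∀ ε ∈ Set.Icc (0 : ℝ) (1 / 2 ^ (k * d)), ε < δ →
      2 / (5 * Real.log 2) * (1 / 2 ^ (k * d)) < DyadicPorosity.tDrop d k ε) := by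
  open DyadicPorosity in
  refine ⟨fun ε hε => ⟨?_, fun η _ μ _ hμ hpor => packingDim_le hd hk hε hμ hpor⟩,
    fun ε hε => ?_, ?_⟩
  · rw [(setOf_rootEquation hd hk hε).1]
    exact isGreatest_singleton
  · exact sub_pos.2 (sRoot_lt_of_rootGap_neg hd hk ⟨hε.1, hε.2.le⟩
      (rootGap_natCast_neg hd hk hε.1 hε.2))
  · obtain ⟨δ, hδ, h⟩ := exists_rootGap_neg_near_zero hd hk (holeWeight_lt_one hd hk)
    refine ⟨δ, hδ, fun ε hε hεδ => ?_⟩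
    have := sRoot_lt_of_rootGap_neg hd hk hε (h ε hε.1 hεδ)
    rw [tDrop]
    linarith
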